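/- Let $p$ be a prime and let $G$ be a finite $p$-group. The power graph $\mathcal{P}(G)$ is the simple undirected graph with vertex set $G$ in which two distinct elements are adjacent if and only if one of them is a power of the other. For a graph $\Gamma$, the vertex connectivity $\kappa(\Gamma)$ is the minimum number of vertices whose deletion leaves a disconnected graph or a graph with at most one vertex. A cyclic vertex cutset of $\Gamma$ is a set $S$ of vertices such that $\Gamma - S$ is disconnected and at least two of its connected components contain cycles. The cyclic vertex connectivity $c\kappa(\Gamma)$ is the minimum cardinality of a cyclic vertex cutset of $\Gamma$, and $c\kappa(\Gamma)=\infty$ if $\Gamma$ has no cyclic vertex cutset. A maximal cyclic subgroup of $G$ is a cyclic subgroup that is not properly contained in any other cyclic subgroup of $G$. Then $\kappa(\mathcal{P}(G)) = c\kappa(\mathcal{P}(G))$ if and only if one of the following conditions holds: (i) $p>3$ and $G$ is non-cyclic; (ii) $p\in\{2,3\}$ and $G$ has at least two maximal cyclic subgroups of order greater than $p$ with trivial intersection, that is, there are distinct maximal cyclic subgroups $M$ and $N$ of $G$ with $|M|>p$, $|N|>p$ and $M\cap N=\{e\}$. Moreover, if (i) or (ii) holds, then $\kappa(\mathcal{P}(G))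 = c\kappa(\mathcal{P}(G)) = 1$. -/

import Mathlib

namespace SimpleGraph

variable {V : Type*}

/-- A vertex cutset: a set `S` of vertices whose deletion leaves a disconnected graph, i.e. one
having two vertices that are not joined by a walk. -/
def IsVertexCutset (Γ : SimpleGraph V) (S : Set V) : Prop :=
  ¬ (Γ.induce Sᶜ).Preconnected

/-- A cyclic vertex cutset: a vertex cutset whose deletion leaves at least two connected
components containing cycles. -/
def IsCyclicVertexCutset (Γ : SimpleGraph V) (S : Set V) : Prop :=
  Γ.IsVertexCutset S ∧
    ∃ C D : (Γ.induce Sᶜ).ConnectedComponent, C ≠ D ∧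
      ¬ C.toSimpleGraph.IsAcyclic ∧ ¬ D.toSimpleGraph.IsAcyclic

/-- The vertex connectivity: the least number of vertices whose deletion leaves a disconnected
graph or a trivial one (with at most one vertex). -/
noncomputable def vertexConnectivity (Γ : SimpleGraph V) : ℕ∞ :=
  ⨅ S ∈ {S : Set V | Γ.IsVertexCutset S ∨ Sᶜ.Subsingleton}, S.encard

/-- The cyclic vertex connectivity: the least cardinality of a cyclic vertex cutset, and infinity
if there is none. -/
noncomputable def cyclicVertexConnectivity (Γ : SimpleGraph V) : ℕ∞ :=
  ⨅ S ∈ {S : Set V | Γ.IsCyclicVertexCutset S}, S.encard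

end SimpleGraph

/-- The power graph of a group: two distinct elements are adjacent if one of them is a power of
the other. -/
def powerGraph (G : Type*) [Group G] : SimpleGraph G where
  Adj x y := x ≠ y ∧ (x ∈ Subgroup.zpowers y ∨ y ∈ Subgroup.zpowers x)
  symm := ⟨fun _ _ h => ⟨h.1.symm, h.2.symm⟩⟩
  loopless := ⟨fun _ h => h.1 rfl⟩

/-- A maximal cyclic subgroup: a cyclic subgroup not properly contained in another one. -/
def Subgroup.IsMaximalCyclic {G : Type*} [Group G] (M : Subgroup G) : Prop :=
  Maximal (fun H : Subgroup G => IsCyclic H) M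

/-- The condition on a `p`-group `G`: either `p > 3` and `G` is non-cyclic, or `p ∈ {2, 3}` and `G`
has two maximal cyclic subgroups of order greater than `p` with trivial intersection. -/
def PowerGraphCondition (p : ℕ) (G : Type*) [Group G] : Prop :=
  (3 < p ∧ ¬ IsCyclic G) ∨
    ((p = 2 ∨ p = 3) ∧ ∃ M N : Subgroup G, M ≠ N ∧ M.IsMaximalCyclic ∧ N.IsMaximalCyclic ∧
      p < Nat.card M ∧ p < Nat.card N ∧ M ⊓ N = ⊥)

/-! The identity is adjacent to every other vertex, so every vertex cutset contains it. In a finite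
`p`-group each nontrivial element has a unique subgroup of order `p` among its powers, and this
subgroup is constant on the components left after deleting the identity.

If there are two subgroups of order `p`, deleting the identity disconnects the graph, so κ = 1 and
equality holds exactly when `{1}` is a cyclic cutset. An element of order at least 4 lies on a
triangle, which settles `p > 3`; for `p ≤ 3` a component with a cycle needs an element of order
greater than `p`, and two such elements in different components extend to maximal cyclic subgroups
meeting trivially.

If there is one subgroup of order `p`, or none, equality fails. When `G` is cyclic the graph is
complete and has no cutset at all. Otherwise `p = 2`; the involution `z` gives the cutset `{1, z}`,
so κ ≤ 2, while `IsPGroup.exists_sq_eq_and_mem_zpowers` supplies a third element lying in every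
cyclic cutset. The criterion `IsPGroup.isCyclic_of_forall_pow_eq_one` replaces the classification of
`p`-groups with a unique subgroup of order `p`. -/

open Subgroup

/-! ### Powers and divisibility of orders in cyclic subgroups. -/

section CyclicSubgroups

variable {G : Type*} [Group G]

/-- With `n = orderOf b`, a cyclic group has at most `n` solutions of `x ^ n = 1`, and the powers of
`b` already exhaust them. -/
theorem mem_zpowers_of_orderOf_dvd_of_isCyclic [Finite G] [IsCyclic G] {a b : G}
    (h : orderOf a ∣ orderOf b) : a ∈ zpowers b := by
  classical
  have := Fintype.ofFinite G
  have hle : (Finset.univ.filter fun x : G => x ^ orderOf b = 1).card ≤ orderOf b :=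
    IsCyclic.card_pow_eq_one_le (orderOf_pos b)
  have hsub : (zpowers b : Set G).toFinset ⊆ Finset.univ.filter fun x : G => x ^ orderOf b = 1 := by
    intro x hx
    have hx' : x ∈ zpowers b := by simpa using hx
    simpa using orderOf_dvd_iff_pow_eq_one.1 (orderOf_dvd_of_mem_zpowers hx')
  have hcard : (zpowers b : Set G).toFinset.card = orderOf b := by
    rw [Set.toFinset_card]
    exact Fintype.card_zpowers
  have heq := Finset.eq_of_subset_of_card_le hsub (hcard ▸ hle)
  have ha : a ∈ (zpowers b : Set G).toFinset := by
    rw [heq]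
    simpa using orderOf_dvd_iff_pow_eq_one.1 h
  simpa using ha

theorem mem_zpowers_of_orderOf_dvd [Finite G] {a b m : G} (ha : a ∈ zpowers m)
    (hb : b ∈ zpowers m) (h : orderOf a ∣ orderOf b) : a ∈ zpowers b := by
  have key : (⟨a, ha⟩ : zpowers m) ∈ zpowers (⟨b, hb⟩ : zpowers m) :=
    mem_zpowers_of_orderOf_dvd_of_isCyclic (by simpa [Subgroup.orderOf_mk] using h)
  obtain ⟨k, hk⟩ := mem_zpowers_iff.1 key
  exact mem_zpowers_iff.2 ⟨k, by simpa using congrArg Subtype.val hk⟩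

variable {p : ℕ} [Fact p.Prime]

theorem IsPGroup.mem_zpowers_or_mem_zpowers [Finite G] (hG : IsPGroup p G) {a b m : G}
    (ha : a ∈ zpowers m) (hb : b ∈ zpowers m) : a ∈ zpowers b ∨ b ∈ zpowers a := by
  obtain ⟨i, hi⟩ := hG.exists_orderOf_eq_pow a
  obtain ⟨j, hj⟩ := hG.exists_orderOf_eq_pow b
  rcases le_total i j with h | h
  · exact .inl (mem_zpowers_of_orderOf_dvd ha hb (hi ▸ hj ▸ pow_dvd_pow p h))
  · exact .inr (mem_zpowers_of_orderOf_dvd hb ha (hi ▸ hj ▸ pow_dvd_pow p h))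

theorem IsPGroup.exists_mem_zpowers_orderOf_eq_prime (hG : IsPGroup p G) {x : G} (hx : x ≠ 1) :
    ∃ u ∈ zpowers x, orderOf u = p := by
  obtain ⟨n, hn⟩ := hG.exists_orderOf_eq_pow x
  have hd := hG.dvd_orderOf hx
  have hp : p.Prime := Fact.out
  have h0 : orderOf x ≠ 0 := hn ▸ pow_ne_zero _ hp.ne_zero
  refine ⟨x ^ (orderOf x / p), npow_mem_zpowers _ _, ?_⟩
  exact orderOf_pow_orderOf_div h0 hd

end CyclicSubgroups

/-! ### Collection formulas when the commutator is central. -/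

section ClassTwo

variable {G : Type*} [Group G]

theorem pow_mul_eq_of_commutator_commute {x t c : G} (h : t * x = x * t * c) (ht : Commute c t)
    (n : ℕ) : t ^ n * x = x * t ^ n * c ^ n := by
  induction n with
  | zero => simp
  | succ n ih =>
    have h1 : Commute (c ^ n) t := ht.pow_left n
    calc t ^ (n + 1) * x = t * (t ^ n * x) := by rw [pow_succ']; group
      _ = (t * x) * t ^ n * c ^ n := by rw [ih]; group
      _ = x * t * (c * t ^ n) * c ^ n := by rw [h]; group
      _ = x * t * (t ^ n * c) * c ^ n := by rw [(ht.pow_right n).eq]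
      _ = x * t ^ (n + 1) * c ^ (n + 1) := by rw [pow_succ' t, pow_succ' c]; group

/-- Moving each `x` to the left past the preceding copies of `t` costs one `c` per pair of factors,
hence the binomial exponent. -/
theorem mul_pow_eq_of_commutator_commute {x t c : G} (h : t * x = x * t * c) (hx : Commute c x)
    (ht : Commute c t) (n : ℕ) : (x * t) ^ n = x ^ n * t ^ n * c ^ n.choose 2 := by
  induction n with
  | zero => simp
  | succ n ih =>
    have h1 : Commute (c ^ n.choose 2) (x * t) := (hx.pow_left _).mul_right (ht.pow_left _)
    have h2 : Commute (c ^ n) t := ht.pow_left n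
    calc (x * t) ^ (n + 1) = x ^ n * t ^ n * (c ^ n.choose 2 * (x * t)) := by
          rw [pow_succ, ih]; group
      _ = x ^ n * (t ^ n * x) * t * c ^ n.choose 2 := by rw [h1.eq]; group
      _ = x ^ n * x * t ^ n * (c ^ n * t) * c ^ n.choose 2 := by
          rw [pow_mul_eq_of_commutator_commute h ht]; group
      _ = x ^ n * x * t ^ n * (t * c ^ n) * c ^ n.choose 2 := by rw [h2.eq]
      _ = x ^ (n + 1) * t ^ (n + 1) * c ^ (n + 1).choose 2 := by
          rw [pow_succ x, pow_succ t, Nat.choose_succ_succ' n 1, Nat.choose_one_right, pow_add c]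
          group

end ClassTwo

/-! ### Two-groups with a unique involution. -/

section Quaternion

variable {G : Type*} [Group G]

/-- A finite `2`-group with a unique involution `z` and order greater than two has an element `g`
with square `z` lying in every cyclic subgroup of order greater than four. -/
theorem IsPGroup.exists_sq_eq_and_mem_zpowers [Finite G] (hG : IsPGroup 2 G) {z : G}
    (hz : orderOf z = 2) (huniq : ∀ u : G, u ^ 2 = 1 → u = 1 ∨ u = z) (htop : zpowers z ≠ ⊤) :
    ∃ g : G, g ^ 2 = z ∧ ∀ x : G, x ^ 4 ≠ 1 → g ∈ zpowers x := by
  have hz2 : z ^ 2 = 1 := hz ▸ pow_orderOf_eq_one z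
  have hz1 : z ≠ 1 := fun h => by simp [h] at hz
  have hzc : ∀ h : G, h * z * h⁻¹ = z := by
    intro h
    rcases huniq (h * z * h⁻¹) (by rw [conj_pow, hz2]; group) with h1 | h1
    · exact absurd (conj_eq_one_iff.1 h1) hz1
    · exact h1
  have hmem : ∀ y : G, y ∈ zpowers z ↔ y = 1 ∨ y = z := by
    refine fun y => ⟨fun hy => huniq y ?_, ?_⟩
    · exact orderOf_dvd_iff_pow_eq_one.1 (hz ▸ orderOf_dvd_of_mem_zpowers hy)
    · rintro (rfl | rfl)
      · exact one_mem _
      · exact mem_zpowers y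
  have hnorm : (zpowers z).Normal := ⟨fun y hy h => by
    rcases (hmem y).1 hy with rfl | rfl
    · simp
    · rw [hzc]; exact mem_zpowers y⟩
  have hQ : IsPGroup 2 (G ⧸ zpowers z) := hG.to_quotient _
  have : Nontrivial (G ⧸ zpowers z) := QuotientGroup.nontrivial_iff.2 htop
  have := hQ.center_nontrivial
  -- The element `g` will be a lift of a central involution of the quotient by `⟨z⟩`.
  obtain ⟨c, hc⟩ := exists_ne (1 : center (G ⧸ zpowers z))
  obtain ⟨u, -, hu⟩ := (hQ.to_subgroup (center _)).exists_mem_zpowers_orderOf_eq_prime hc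
  obtain ⟨g, hg⟩ := QuotientGroup.mk_surjective (u : G ⧸ zpowers z)
  have hu1 : (g : G ⧸ zpowers z) ≠ 1 := by
    rw [hg]
    rintro h
    rw [OneMemClass.coe_eq_one] at h
    simp [h] at hu
  have hgz : g ∉ zpowers z := fun h => hu1 ((QuotientGroup.eq_one_iff g).2 h)
  have hu2 : (u : G ⧸ zpowers z) ^ 2 = 1 := by
    rw [← SubmonoidClass.coe_pow, ← hu, pow_orderOf_eq_one]; rfl
  have hg2 : g ^ 2 = z := by
    have : g ^ 2 ∈ zpowers z := by
      rw [← QuotientGroup.eq_one_iff, QuotientGroup.mk_pow, hg, hu2]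
    rcases (hmem _).1 this with h | h
    · exact absurd ((hmem g).2 (huniq g h)) hgz
    · exact h
  -- The commutator of `x` and `g` lies in `⟨z⟩`, which is central of order 2, so it disappears on
  -- squaring `x`.
  have hcomm : ∀ x : G, Commute (x ^ 2) g := by
    intro x
    have hq : ((x * g : G) : G ⧸ zpowers z) = ((g * x : G) : G ⧸ zpowers z) := by
      rw [QuotientGroup.mk_mul, QuotientGroup.mk_mul, hg]
      exact mem_center_iff.1 u.2 _
    have hmz := (hmem _).1 (QuotientGroup.eq.1 hq.symm)
    have hxz : Commute x z := by
      have := hzc x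
      exact mul_inv_eq_iff_eq_mul.1 this
    have hxg : x * g = g * x ∨ x * g = g * x * z := by
      rcases hmz with h | h
      · exact .inl (inv_mul_eq_one.1 h).symm
      · exact .inr (inv_mul_eq_iff_eq_mul.1 h)
    rcases hxg with h | h
    · exact Commute.pow_left h 2
    · change x ^ 2 * g = g * x ^ 2
      calc x ^ 2 * g = x * (x * g) := by rw [pow_two, mul_assoc]
        _ = (x * g) * x * z := by nth_rw 1 [h]; simp only [mul_assoc]
        _ = g * x * (z * x) * z := by rw [h]; group
        _ = g * x ^ 2 * z ^ 2 := by rw [← hxz.eq]; simp only [pow_two, mul_assoc]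
        _ = g * x ^ 2 := by rw [hz2, mul_one]
  refine ⟨g, hg2, fun x hx => ?_⟩
  obtain ⟨n, hn⟩ := hG.exists_orderOf_eq_pow x
  have hn3 : 3 ≤ n := by
    by_contra hlt
    refine hx (orderOf_dvd_iff_pow_eq_one.1 ?_)
    rw [hn, show (4 : ℕ) = 2 ^ 2 by norm_num]
    exact pow_dvd_pow 2 (by omega)
  obtain ⟨k, rfl⟩ := Nat.exists_eq_add_of_le hn3
  -- `w` has order 4 and is itself a square because `orderOf x ≥ 8`, so it commutes with `g`. Both
  -- square to `z`, so `w * g` squares to 1 and is `1` or `z`, a power of `x` either way.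
  set w := x ^ 2 ^ (k + 1) with hw
  have hw4 : (w ^ 2) ^ 2 = 1 := by
    rw [hw, ← pow_mul, ← pow_mul, ← pow_orderOf_eq_one x, hn]
    congr 1
    ring
  have hwne : w ^ 2 ≠ 1 := by
    intro h
    rw [hw, ← pow_mul, ← orderOf_dvd_iff_pow_eq_one, hn, ← pow_succ,
      Nat.pow_dvd_pow_iff_le_right (by norm_num)] at h
    omega
  have hw2 : w ^ 2 = z := (huniq _ hw4).resolve_left hwne
  have hwg : Commute w g := by
    have : w = (x ^ 2 ^ k) ^ 2 := by rw [hw, ← pow_mul, pow_succ]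
    rw [this]
    exact hcomm _
  have hwx : w ∈ zpowers x := npow_mem_zpowers _ _
  have hprod : w * g ∈ zpowers x := by
    rcases huniq (w * g) (by rw [hwg.mul_pow, hw2, hg2, ← pow_two, hz2]) with h | h
    · rw [h]; exact one_mem _
    · rw [h, ← hw2]; exact pow_mem hwx 2
  simpa using mul_mem (inv_mem hwx) hprod

end Quaternion

/-! ### A criterion for a finite `p`-group to be cyclic. -/

section CyclicCriterion

theorem IsPGroup.normal_of_card_mul_prime_eq {p : ℕ} [Fact p.Prime] {G : Type*} [Group G]
    [Finite G] {n : ℕ} (hcard : Nat.card G = p ^ (n + 1)) {M : Subgroup G}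
    (hM : Nat.card M = p ^ n) : M.Normal ∧ M.index = p := by
  have hp : p.Prime := Fact.out
  have hidx : M.index = p := by
    have := M.card_mul_index
    rw [hM, hcard, pow_succ] at this
    exact Nat.eq_of_mul_eq_mul_left (pow_pos hp.pos n) this
  refine ⟨normal_of_index_eq_minFac_card ?_, hidx⟩
  rw [hidx, hcard, Nat.Prime.pow_minFac hp n.succ_ne_zero]

/-- Let `x` and `y` generate distinct subgroups of index `p` in a finite `p`-group. Then some
`x * y ^ m` has trivial `k`-th power, for every `k` such that `p` divides `k` and `k.choose 2`. -/
theorem IsPGroup.exists_mul_zpow_pow_eq_one {p : ℕ} [Fact p.Prime] {G : Type*} [Group G]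
    [Finite G] {n : ℕ} (hcard : Nat.card G = p ^ (n + 1)) {x y : G} (hx : orderOf x = p ^ n)
    (hy : orderOf y = p ^ n) (hyx : y ∉ zpowers x) {k : ℕ} (hk : p ∣ k)
    (hk2 : p ∣ k.choose 2) : ∃ m : ℤ, (x * y ^ m) ^ k = 1 := by
  obtain ⟨hMn, hMi⟩ := normal_of_card_mul_prime_eq hcard (M := zpowers x) (by simpa using hx)
  obtain ⟨hNn, hNi⟩ := normal_of_card_mul_prime_eq hcard (M := zpowers y) (by simpa using hy)
  have hp : p.Prime := Fact.out
  have hxp : x ^ p ∈ zpowers y := hNi ▸ pow_index_mem _ x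
  obtain ⟨j, hj⟩ := mem_zpowers_iff.1 hxp
  -- Otherwise `y ^ j = x ^ p` would generate `⟨y⟩`, putting `y` in `⟨x⟩`.
  have hpj : (p : ℤ) ∣ j := by
    by_contra hpj
    refine hyx ?_
    have hcop : IsCoprime j ((p ^ n : ℕ) : ℤ) := by
      push_cast
      exact (((Nat.prime_iff_prime_int.1 hp).coprime_iff_not_dvd.2 hpj).symm).pow_right
    obtain ⟨a, b, hab⟩ := hcop
    have : y = (x ^ p) ^ a := by
      calc y = y ^ (a * j + b * ((p ^ n : ℕ) : ℤ)) := by rw [hab, zpow_one]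
        _ = (x ^ p) ^ a := by
          rw [zpow_add, mul_comm a, zpow_mul, hj, mul_comm b, zpow_mul, zpow_natCast, ← hy,
            pow_orderOf_eq_one, one_zpow, mul_one]
    rw [this]
    exact zpow_mem (npow_mem_zpowers _ _) _
  obtain ⟨m, rfl⟩ := hpj
  refine ⟨-m, ?_⟩
  -- Chosen so that `t ^ p` cancels `x ^ p`. The commutator `c` lies in both normal subgroups `⟨x⟩`
  -- and `⟨y⟩`, so it commutes with `x` and `t`.
  set t := y ^ (-m) with ht
  have htN : t ∈ zpowers y := zpow_mem_zpowers _ _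
  have htp : t ^ p = (x ^ p)⁻¹ := by
    rw [← hj, ht, ← zpow_natCast, ← zpow_mul, ← zpow_neg]
    congr 1
    ring
  set c := t⁻¹ * x⁻¹ * t * x with hc
  have hrel : t * x = x * t * c := by rw [hc]; group
  have hcM : c ∈ zpowers x := by
    refine mul_mem ?_ (mem_zpowers x)
    simpa using hMn.conj_mem _ (inv_mem (mem_zpowers x)) t⁻¹
  have hcN : c ∈ zpowers y := by
    rw [hc, mul_assoc, mul_assoc]
    refine mul_mem (inv_mem htN) ?_
    simpa [mul_assoc] using hNn.conj_mem _ htN x⁻¹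
  have hcx : Commute c x := by
    obtain ⟨i, hi⟩ := mem_zpowers_iff.1 hcM
    rw [← hi]
    exact (Commute.refl x).zpow_left i
  have hct : Commute c t := by
    obtain ⟨i, hi⟩ := mem_zpowers_iff.1 hcN
    rw [← hi, ht]
    exact ((Commute.refl y).zpow_left i).zpow_right _
  have hcp : c ^ p = 1 := by
    have h1 := pow_mul_eq_of_commutator_commute hrel hct p
    have h2 : t ^ p * x = x * t ^ p := by
      rw [htp]
      exact ((Commute.refl x).pow_left p).inv_left
    rw [h2] at h1
    exact (mul_eq_left.1 h1.symm)
  rw [mul_pow_eq_of_commutator_commute hrel hcx hct]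
  obtain ⟨l, rfl⟩ := hk
  obtain ⟨l', hl'⟩ := hk2
  rw [hl', pow_mul c, hcp, one_pow, mul_one, pow_mul, pow_mul, htp, inv_pow, mul_inv_cancel]

/-- A finite `p`-group is cyclic if its elements of exponent `k` are determined by their order up
to taking powers, where `p` divides both `k` and `k.choose 2`. -/
theorem IsPGroup.isCyclic_of_forall_pow_eq_one {p : ℕ} [Fact p.Prime] {G : Type*} [Group G]
    [Finite G] (hG : IsPGroup p G) {k : ℕ} (hk : p ∣ k) (hk2 : p ∣ k.choose 2)
    (h : ∀ u v : G, u ^ k = 1 → v ^ k = 1 → orderOf u ∣ orderOf v → u ∈ zpowers v) :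
    IsCyclic G := by
  have hp : p.Prime := Fact.out
  induction hN : Nat.card G using Nat.strong_induction_on generalizing G with
  | _ N ih =>
  by_contra hncyc
  -- In a minimal counterexample every proper subgroup is cyclic.
  have hproper : ∀ H : Subgroup G, H ≠ ⊤ → IsCyclic H := by
    intro H hH
    refine ih (Nat.card H) ?_ (hG.to_subgroup H) ?_ rfl
    · rw [← hN]
      exact lt_of_le_of_ne H.card_le_card_group fun h => hH (H.eq_top_of_card_eq h)
    · intro u v hu hv huv
      have := h u v (by exact_mod_cast congrArg Subtype.val hu)
        (by exact_mod_cast congrArg Subtype.val hv) (by simpa using huv)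
      obtain ⟨i, hi⟩ := mem_zpowers_iff.1 this
      exact mem_zpowers_iff.2 ⟨i, Subtype.ext (by simpa using hi)⟩
  obtain ⟨n, hcard⟩ := IsPGroup.iff_card.1 hG
  rcases n with _ | n
  · have : Subsingleton G := (Nat.card_eq_one_iff_unique.1 (by simpa using hcard)).1
    exact hncyc inferInstance
  have hmax : ∀ g : G, ∃ x : G, orderOf x = p ^ n ∧ g ∈ zpowers x := by
    intro g
    obtain ⟨i, hi⟩ := hG.exists_orderOf_eq_pow g
    have hgcard : Nat.card (zpowers g) = p ^ i := by simpa using hi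
    have hin : i ≤ n := by
      by_contra hlt
      refine hncyc (isCyclic_of_orderOf_eq_card g (Nat.dvd_antisymm (orderOf_dvd_natCard g) ?_))
      rw [hcard, hi]
      exact pow_dvd_pow p (by omega)
    obtain ⟨M, hM, hgM⟩ := Sylow.exists_subgroup_card_pow_prime_le p
      (hcard ▸ pow_dvd_pow p n.le_succ) (zpowers g) hgcard hin
    have hMtop : M ≠ ⊤ := by
      rintro rfl
      rw [card_top, hcard] at hM
      exact absurd (Nat.pow_right_injective hp.two_le hM) (by omega)
    obtain ⟨x, hx⟩ := (Subgroup.isCyclic_iff_exists_zpowers_eq_top M).1 (hproper M hMtop)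
    exact ⟨x, by rw [← Nat.card_zpowers, hx, hM], hx ▸ hgM (mem_zpowers g)⟩
  obtain ⟨x, hx, -⟩ := hmax 1
  have hxtop : ∃ g, g ∉ zpowers x := by
    by_contra! hall
    exact hncyc ⟨x, hall⟩
  obtain ⟨g, hg⟩ := hxtop
  obtain ⟨y, hy, hgy⟩ := hmax g
  have hyx : y ∉ zpowers x := fun h => hg (zpowers_le.2 h hgy)
  have hxy : x ∉ zpowers y := fun h =>
    hyx (mem_zpowers_of_orderOf_dvd (mem_zpowers y) h (by rw [hx, hy]))
  obtain ⟨m, hm⟩ := exists_mul_zpow_pow_eq_one hcard hx hy hyx hk hk2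
  refine hxy ?_
  suffices hmem : x * y ^ m ∈ zpowers y by
    exact (mul_mem_cancel_right (zpow_mem_zpowers y m)).1 hmem
  obtain ⟨i, hi⟩ := hG.exists_orderOf_eq_pow (x * y ^ m)
  have hin : i ≤ n := by
    obtain ⟨w, hw, hmw⟩ := hmax (x * y ^ m)
    have := orderOf_dvd_of_mem_zpowers hmw
    rwa [hi, hw, Nat.pow_dvd_pow_iff_le_right hp.one_lt] at this
  -- A power of `y` with the same order as `x * y ^ m`; the hypothesis then forces `x * y ^ m`,
  -- hence `x`, into `⟨y⟩`.
  have hv : orderOf (y ^ p ^ (n - i)) = p ^ i := by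
    rw [orderOf_pow, hy, Nat.gcd_eq_right (pow_dvd_pow p (Nat.sub_le n i)),
      Nat.pow_div (Nat.sub_le n i) hp.pos]
    congr 1
    omega
  have := h (x * y ^ m) (y ^ p ^ (n - i)) hm ?_ (by rw [hi, hv])
  · exact zpowers_le.2 (npow_mem_zpowers _ _) this
  · rw [← orderOf_dvd_iff_pow_eq_one, hv, ← hi, orderOf_dvd_iff_pow_eq_one, hm]

theorem IsPGroup.exists_orderOf_eq_prime_not_mem_zpowers {p : ℕ} [Fact p.Prime] {G : Type*}
    [Group G] [Finite G] (hG : IsPGroup p G) (hp2 : p ≠ 2) (hcyc : ¬ IsCyclic G) :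
    ∃ u v : G, orderOf u = p ∧ orderOf v = p ∧ u ∉ zpowers v := by
  have hp : p.Prime := Fact.out
  by_contra! hall
  refine hcyc (hG.isCyclic_of_forall_pow_eq_one (k := p) dvd_rfl ?_ ?_)
  · exact hp.dvd_choose_self two_ne_zero (lt_of_le_of_ne hp.two_le hp2.symm)
  · intro u v hu hv huv
    by_cases hu1 : u = 1
    · exact hu1 ▸ one_mem _
    have huo := orderOf_eq_prime hu hu1
    refine hall u v huo (orderOf_eq_prime hv ?_)
    rintro rfl
    rw [orderOf_one, Nat.dvd_one, huo] at huv
    exact hp.one_lt.ne' huv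

theorem IsPGroup.exists_orderOf_eq_four_not_mem_zpowers {G : Type*}
    [Group G] [Finite G] (hG : IsPGroup 2 G) (hcyc : ¬ IsCyclic G)
    (huniq : ∀ u v : G, orderOf u = 2 → orderOf v = 2 → u ∈ zpowers v) :
    ∃ u v : G, orderOf u = 4 ∧ orderOf v = 4 ∧ u ∉ zpowers v := by
  by_contra! hall
  -- The exponent 2 is unavailable since `Nat.choose 2 2 = 1` is odd, whereas `Nat.choose 4 2 = 6`
  -- is even.
  refine hcyc (hG.isCyclic_of_forall_pow_eq_one (k := 4) (by norm_num) (by decide) ?_)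
  intro u v hu hv huv
  by_cases hu1 : u = 1
  · exact hu1 ▸ one_mem _
  have hv1 : v ≠ 1 := by
    rintro rfl
    rw [orderOf_one, Nat.dvd_one, orderOf_eq_one_iff] at huv
    exact hu1 huv
  by_cases hu2 : u ^ 2 = 1
  · obtain ⟨w, hwv, hw⟩ := hG.exists_mem_zpowers_orderOf_eq_prime hv1
    exact zpowers_le.2 hwv (huniq u w (orderOf_eq_prime hu2 hu1) hw)
  · have hu4 : orderOf u = 4 := orderOf_eq_prime_pow (p := 2) (n := 1) (by simpa) (by simpa)
    refine hall u v hu4 (Nat.dvd_antisymm (orderOf_dvd_of_pow_eq_one hv) (hu4 ▸ huv))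

end CyclicCriterion

/-! ### Cutsets, dominating vertices and cycles in components. -/

namespace SimpleGraph

variable {V : Type*} {Γ : SimpleGraph V}

theorem IsVertexCutset.mem_of_forall_adj {S : Set V} (hS : Γ.IsVertexCutset S) {w : V}
    (hw : ∀ v, v ≠ w → Γ.Adj w v) : w ∈ S := by
  by_contra hwS
  refine hS fun a b => ?_
  have key : ∀ c : ↥Sᶜ, (Γ.induce Sᶜ).Reachable ⟨w, hwS⟩ c := by
    intro c
    by_cases hc : (c : V) = w
    · exact (show (⟨w, hwS⟩ : ↥Sᶜ) = c from Subtype.ext hc.symm) ▸ Reachable.refl _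
    · exact Adj.reachable (hw c hc : Γ.Adj w c)
  exact (key a).symm.trans (key b)

theorem ConnectedComponent.exists_adj_adj_of_not_isAcyclic {C : Γ.ConnectedComponent}
    (hC : ¬ C.toSimpleGraph.IsAcyclic) :
    ∃ v ∈ C, ∃ a ∈ C, ∃ b ∈ C, Γ.Adj v a ∧ Γ.Adj v b ∧ a ≠ b := by
  simp only [IsAcyclic, not_forall, not_not] at hC
  obtain ⟨v, w, hw⟩ := hC
  refine ⟨v, v.2, w.snd, w.snd.2, w.penultimate, w.penultimate.2, ?_, ?_, ?_⟩
  · exact w.adj_snd hw.not_nil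
  · exact (w.adj_penultimate hw.not_nil).symm
  · exact fun h => hw.snd_ne_penultimate (Subtype.ext h)

theorem not_isAcyclic_connectedComponentMk_of_triangle {a b c : V} (hab : Γ.Adj a b)
    (hac : Γ.Adj a c) (hbc : Γ.Adj b c) :
    ¬ (Γ.connectedComponentMk a).toSimpleGraph.IsAcyclic := by
  classical
  intro h
  set C := Γ.connectedComponentMk a
  have ha : a ∈ C := rfl
  have hb : b ∈ C := ConnectedComponent.sound hab.reachable.symm
  have hc : c ∈ C := ConnectedComponent.sound hac.reachable.symm
  refine h.cliqueFree le_rfl {⟨a, ha⟩, ⟨b, hb⟩, ⟨c, hc⟩} ?_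
  rw [is3Clique_triple_iff]
  exact ⟨hab, hac, hbc⟩

theorem one_le_cyclicVertexConnectivity {w : V} (hw : ∀ v, v ≠ w → Γ.Adj w v) :
    1 ≤ Γ.cyclicVertexConnectivity := by
  refine le_iInf₂ fun S hS => ?_
  exact Set.one_le_encard_iff_nonempty.2 ⟨w, IsVertexCutset.mem_of_forall_adj hS.1 hw⟩

theorem vertexConnectivity_eq_one [Nontrivial V] {w : V} (hw : ∀ v, v ≠ w → Γ.Adj w v)
    (hcut : Γ.IsVertexCutset {w}) : Γ.vertexConnectivity = 1 := by
  apply le_antisymm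
  · exact (iInf₂_le ({w} : Set V) (Or.inl hcut)).trans (by simp)
  · refine le_iInf₂ fun S hS => Set.one_le_encard_iff_nonempty.2 ?_
    rcases hS with hS | hS
    · exact ⟨w, hS.mem_of_forall_adj hw⟩
    · by_contra hne
      rw [Set.not_nonempty_iff_eq_empty] at hne
      rw [hne, Set.compl_empty, Set.subsingleton_univ_iff] at hS
      exact not_subsingleton V hS

theorem IsCyclicVertexCutset.singleton_of_connectivity_eq_one {w : V}
    (hw : ∀ v, v ≠ w → Γ.Adj w v) (h : Γ.cyclicVertexConnectivity = 1) :
    Γ.IsCyclicVertexCutset {w} := by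
  have hlt : Γ.cyclicVertexConnectivity < 2 := h ▸ by norm_num
  simp only [cyclicVertexConnectivity, iInf_lt_iff] at hlt
  obtain ⟨S, hS, hS2⟩ := hlt
  have hwS : w ∈ S := IsVertexCutset.mem_of_forall_adj hS.1 hw
  have hS1 : S.encard ≤ 1 := Order.le_of_lt_add_one (by simpa [one_add_one_eq_two] using hS2)
  have : S = {w} := Set.eq_singleton_iff_unique_mem.2
    ⟨hwS, fun x hx => Set.encard_le_one_iff.1 hS1 x w hx hwS⟩
  exact this ▸ hS

end SimpleGraph

/-! ### Components and cycles of power graphs. -/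

section PowerGraph

variable {G : Type*} [Group G]

theorem powerGraph_one_adj {v : G} (hv : v ≠ 1) : (powerGraph G).Adj 1 v :=
  ⟨hv.symm, .inl (one_mem _)⟩

theorem powerGraph_induce_reachable_of_mem_zpowers {S : Set G} {x w : ↥Sᶜ}
    (h : (x : G) ∈ zpowers (w : G) ∨ (w : G) ∈ zpowers (x : G)) :
    ((powerGraph G).induce Sᶜ).Reachable x w := by
  by_cases hxw : x = w
  · exact hxw ▸ SimpleGraph.Reachable.refl _
  · exact SimpleGraph.Adj.reachable
      (show (powerGraph G).Adj x w from ⟨fun h => hxw (Subtype.ext h), h⟩)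

/-- The vertices `m`, `m⁻¹`, `m ^ 2` form a triangle avoiding the identity. -/
theorem powerGraph_not_isAcyclic_of_four_le_orderOf {m : G} (hm : 4 ≤ orderOf m)
    (hm1 : m ∈ ({1} : Set G)ᶜ) :
    ¬ (((powerGraph G).induce ({1} : Set G)ᶜ).connectedComponentMk
      ⟨m, hm1⟩).toSimpleGraph.IsAcyclic := by
  have hpow : ∀ i, 0 < i → i < 4 → m ^ i ≠ 1 := fun i h0 hi =>
    pow_ne_one_of_lt_orderOf h0.ne' (by omega)
  have h2 : m ^ 2 ≠ 1 := hpow 2 (by norm_num) (by norm_num)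
  have h3 : m ^ 3 ≠ 1 := hpow 3 (by norm_num) (by norm_num)
  have hinv : m⁻¹ ∈ ({1} : Set G)ᶜ := by simpa using hm1
  have hsq : m ^ 2 ∈ ({1} : Set G)ᶜ := h2
  refine SimpleGraph.not_isAcyclic_connectedComponentMk_of_triangle
    (b := ⟨m⁻¹, hinv⟩) (c := ⟨m ^ 2, hsq⟩) ?_ ?_ ?_
  · refine (⟨fun h => h2 ?_, .inr (by simp)⟩ : (powerGraph G).Adj m m⁻¹)
    rw [pow_two]
    exact mul_eq_one_iff_eq_inv.2 h
  · refine (⟨fun h => hm1 ?_, .inr (npow_mem_zpowers _ _)⟩ : (powerGraph G).Adj m (m ^ 2))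
    rw [pow_two] at h
    exact left_eq_mul.1 h
  · refine (⟨fun h => h3 ?_, .inr ?_⟩ : (powerGraph G).Adj m⁻¹ (m ^ 2))
    · rw [pow_succ, ← h, inv_mul_cancel]
    · rw [zpowers_inv]
      exact npow_mem_zpowers _ _

variable [Finite G]

/-- If the order of `u` divides that of every vertex outside `S`, then the set of vertices of which
`u` is a power is a union of connected components of the power graph with `S` deleted. -/
theorem powerGraph_mem_zpowers_iff_of_reachable {S : Set G} {u : G}
    (hu : ∀ x ∉ S, orderOf u ∣ orderOf x) {a b : ↥Sᶜ}
    (h : ((powerGraph G).induce Sᶜ).Reachable a b) :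
    u ∈ zpowers (a : G) ↔ u ∈ zpowers (b : G) := by
  obtain ⟨w⟩ := h
  induction w with
  | nil => rfl
  | cons hadj _ ih =>
    rename_i a c _ _
    rw [← ih]
    rcases (show (powerGraph G).Adj a c from hadj).2 with h | h
    · exact ⟨fun hx => zpowers_le.2 h hx,
        fun hx => mem_zpowers_of_orderOf_dvd hx h (hu a a.2)⟩
    · exact ⟨fun hx => mem_zpowers_of_orderOf_dvd hx h (hu c c.2),
        fun hx => zpowers_le.2 h hx⟩

theorem powerGraph_isVertexCutset {S : Set G} {u m n : G}
    (hu : ∀ x ∉ S, orderOf u ∣ orderOf x) (hm : m ∉ S) (hn : n ∉ S) (hum : u ∈ zpowers m)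
    (hun : u ∉ zpowers n) : (powerGraph G).IsVertexCutset S := fun h =>
  hun ((powerGraph_mem_zpowers_iff_of_reachable hu (h ⟨m, hm⟩ ⟨n, hn⟩)).1 hum)

/-- Among three distinct vertices of the power graph, one of them adjacent to the other two, not
all have the same order if that order is at most four. -/
theorem powerGraph_orderOf_ne_of_adj_adj {v a b : G} {m : ℕ} (hm : m ≤ 4)
    (hva : (powerGraph G).Adj v a) (hvb : (powerGraph G).Adj v b) (hab : a ≠ b)
    (hv : orderOf v = m) (ha : orderOf a = m) : orderOf b ≠ m := by
  intro hb
  -- A cyclic group of order at most 4 has at most two generators, so `v⁻¹` is the only candidate.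
  have key : ∀ c, (powerGraph G).Adj v c → orderOf c = m → c = v⁻¹ := by
    intro c hvc hc
    have hcv : c ∈ zpowers v := hvc.2.elim
      (fun h => mem_zpowers_of_orderOf_dvd (mem_zpowers c) h (by rw [hc, hv])) id
    obtain ⟨i, rfl⟩ := (isOfFinOrder_of_finite v).mem_powers_iff_mem_zpowers.2 hcv
    dsimp only at hvc hc ⊢
    have hlt : i % m < m := Nat.mod_lt _ (hv ▸ orderOf_pos v)
    rw [← pow_mod_orderOf, hv] at hvc hc ⊢
    generalize i % m = j at hvc hc hlt
    have hj1 : j ≠ 1 := by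
      rintro rfl
      exact hvc.1 (pow_one v).symm
    rw [orderOf_pow, hv, Nat.div_eq_self] at hc
    have hsucc : j + 1 = m := by
      clear hva hvb hv ha hb hvc hcv
      interval_cases m <;> interval_cases j <;> simp_all
    exact eq_inv_of_mul_eq_one_left (by rw [← pow_succ, hsucc, ← hv, pow_orderOf_eq_one])
  exact hab ((key a hva ha).trans (key b hvb hb).symm)

/-- Applied with `m = p ≤ 3` when only the identity is deleted, and with `m = 4` when the involution
is unique. -/
theorem powerGraph_exists_orderOf_ne_of_not_isAcyclic {S : Set G} {m : ℕ} (hm : m ≤ 4)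
    {C : ((powerGraph G).induce Sᶜ).ConnectedComponent} (hC : ¬ C.toSimpleGraph.IsAcyclic) :
    ∃ x : ↥Sᶜ, ((powerGraph G).induce Sᶜ).connectedComponentMk x = C ∧ orderOf (x : G) ≠ m := by
  obtain ⟨v, hv, a, ha, b, hb, hva, hvb, hab⟩ :=
    SimpleGraph.ConnectedComponent.exists_adj_adj_of_not_isAcyclic hC
  by_contra! h
  exact powerGraph_orderOf_ne_of_adj_adj hm (show (powerGraph G).Adj v a from hva)
    (show (powerGraph G).Adj v b from hvb) (fun h => hab (Subtype.ext h)) (h v hv) (h a ha) (h b hb)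

end PowerGraph

/-! ### Comparison of the two connectivities. -/

section Connectivity

variable {G : Type*} [Group G]

theorem Subgroup.IsMaximalCyclic.exists_generator {p : ℕ} {M : Subgroup G} (hM : M.IsMaximalCyclic)
    (hp : p < Nat.card M) : ∃ m, zpowers m = M ∧ p < orderOf m := by
  obtain ⟨m, rfl⟩ := (Subgroup.isCyclic_iff_exists_zpowers_eq_top _).1 hM.1
  exact ⟨m, rfl, by simpa using hp⟩

variable {p : ℕ} [Fact p.Prime]

theorem IsPGroup.four_le_orderOf (hG : IsPGroup p G) (hp : p = 2 ∨ p = 3) {m : G}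
    (hm : p < orderOf m) : 4 ≤ orderOf m := by
  rcases hp with rfl | rfl
  · have : 2 ∣ orderOf m := hG.dvd_orderOf (by rintro rfl; simp at hm)
    omega
  · exact hm

variable [Finite G]

theorem powerGraph_isCyclicVertexCutset_singleton_one (hG : IsPGroup p G) {u m n : G}
    (hu : orderOf u = p) (hum : u ∈ zpowers m) (hun : u ∉ zpowers n) (hm : 4 ≤ orderOf m)
    (hn : 4 ≤ orderOf n) : (powerGraph G).IsCyclicVertexCutset {1} := by
  have hord : ∀ x ∉ ({1} : Set G), orderOf u ∣ orderOf x := fun x hx => hu ▸ hG.dvd_orderOf hx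
  have hne : ∀ x : G, 4 ≤ orderOf x → x ∈ ({1} : Set G)ᶜ := by
    rintro x hx rfl
    simp at hx
  refine ⟨powerGraph_isVertexCutset hord (hne m hm) (hne n hn) hum hun, _, _, ?_,
    powerGraph_not_isAcyclic_of_four_le_orderOf hm (hne m hm),
    powerGraph_not_isAcyclic_of_four_le_orderOf hn (hne n hn)⟩
  intro h
  exact hun ((powerGraph_mem_zpowers_iff_of_reachable hord
    (SimpleGraph.ConnectedComponent.exact h)).1 hum)

theorem PowerGraphCondition.exists_orderOf_eq_prime (hG : IsPGroup p G)
    (h : PowerGraphCondition p G) : ∃ u m n : G, orderOf u = p ∧ u ∈ zpowers m ∧ u ∉ zpowers n ∧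
      4 ≤ orderOf m ∧ 4 ≤ orderOf n := by
  have hp1 : 1 < p := (Fact.out : p.Prime).one_lt
  rcases h with ⟨hp, hcyc⟩ | ⟨hp, M, N, -, hM, hN, hMp, hNp, hMN⟩
  · obtain ⟨u, v, hu, hv, huv⟩ := hG.exists_orderOf_eq_prime_not_mem_zpowers (by omega) hcyc
    exact ⟨u, u, v, hu, mem_zpowers u, huv, by omega, by omega⟩
  · obtain ⟨m, rfl, hm⟩ := hM.exists_generator hMp
    obtain ⟨n, rfl, hn⟩ := hN.exists_generator hNp
    obtain ⟨u, hum, hu⟩ := hG.exists_mem_zpowers_orderOf_eq_prime (x := m)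
      (by rintro rfl; simp at hm; omega)
    refine ⟨u, m, n, hu, hum, fun hun => ?_, hG.four_le_orderOf hp hm, hG.four_le_orderOf hp hn⟩
    have hu1 : u ∈ zpowers m ⊓ zpowers n := ⟨hum, hun⟩
    rw [hMN, mem_bot] at hu1
    rw [hu1, orderOf_one] at hu
    omega

theorem powerGraph_connectivity_eq_one (hG : IsPGroup p G) (h : PowerGraphCondition p G) :
    (powerGraph G).vertexConnectivity = 1 ∧ (powerGraph G).cyclicVertexConnectivity = 1 := by
  obtain ⟨u, m, n, hu, hum, hun, hm, hn⟩ := h.exists_orderOf_eq_prime hG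
  have hcut := powerGraph_isCyclicVertexCutset_singleton_one hG hu hum hun hm hn
  have : Nontrivial G := ⟨u, 1, fun h => hun (h ▸ one_mem _)⟩
  refine ⟨SimpleGraph.vertexConnectivity_eq_one (fun _ => powerGraph_one_adj) hcut.1,
    le_antisymm ?_ (SimpleGraph.one_le_cyclicVertexConnectivity fun _ => powerGraph_one_adj)⟩
  exact (iInf₂_le ({1} : Set G) hcut).trans (by simp)

/-- The forward implication for a group with at least two subgroups of order `p`. -/
theorem powerGraphCondition_of_not_mem_zpowers (hG : IsPGroup p G) {u v : G} (hu : orderOf u = p)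
    (hv : orderOf v = p) (huv : u ∉ zpowers v)
    (h : (powerGraph G).vertexConnectivity = (powerGraph G).cyclicVertexConnectivity) :
    PowerGraphCondition p G := by
  have hp : p.Prime := Fact.out
  have hp1 := hp.one_lt
  have hne : ∀ x : G, orderOf x = p → x ∉ ({1} : Set G) := by
    rintro x hx rfl
    rw [orderOf_one] at hx
    omega
  have : Nontrivial G := ⟨u, 1, hne u hu⟩
  have hκ := SimpleGraph.vertexConnectivity_eq_one (Γ := powerGraph G)
    (fun _ => powerGraph_one_adj) (powerGraph_isVertexCutset
      (fun x hx => hu ▸ hG.dvd_orderOf hx) (hne u hu) (hne v hv) (mem_zpowers u) huv)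
  obtain ⟨-, C, D, hCD, hC, hD⟩ :=
    SimpleGraph.IsCyclicVertexCutset.singleton_of_connectivity_eq_one
      (fun _ => powerGraph_one_adj) (h ▸ hκ)
  by_cases hp3 : 3 < p
  · refine .inl ⟨hp3, fun _ => huv ?_⟩
    exact mem_zpowers_of_orderOf_dvd_of_isCyclic (by rw [hu, hv])
  have hp23 : p = 2 ∨ p = 3 := by omega
  refine .inr ⟨hp23, ?_⟩
  obtain ⟨x, rfl, hxp⟩ := powerGraph_exists_orderOf_ne_of_not_isAcyclic (by omega : p ≤ 4) hC
  obtain ⟨y, rfl, hyp⟩ := powerGraph_exists_orderOf_ne_of_not_isAcyclic (by omega : p ≤ 4) hD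
  have hmax : ∀ w : G, ∃ M : Subgroup G, zpowers w ≤ M ∧ M.IsMaximalCyclic := fun w =>
    Finite.exists_le_maximal (p := fun H : Subgroup G => IsCyclic H) inferInstance
  obtain ⟨M, hxM, hM⟩ := hmax x
  obtain ⟨N, hyN, hN⟩ := hmax y
  have hcard : ∀ (w : G) (K : Subgroup G), w ≠ 1 → orderOf w ≠ p → zpowers w ≤ K →
      p < Nat.card K := by
    intro w K hw1 hwp hwK
    have h1 : p ≤ orderOf w := Nat.le_of_dvd (orderOf_pos w) (hG.dvd_orderOf hw1)
    have h2 : orderOf w ≤ Nat.card K := by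
      rw [← Nat.card_zpowers]
      exact Subgroup.card_le_of_le hwK
    omega
  -- Elements of a cyclic `p`-group are pairwise comparable, so a nontrivial common `w` would join
  -- `x` to `y`, merging `C` and `D`.
  have hMN : M ⊓ N = ⊥ := by
    rw [eq_bot_iff]
    rintro w ⟨hwM, hwN⟩
    by_contra hw
    have hw1 : w ∈ ({1} : Set G)ᶜ := hw
    obtain ⟨m, rfl⟩ := (Subgroup.isCyclic_iff_exists_zpowers_eq_top _).1 hM.1
    obtain ⟨n, rfl⟩ := (Subgroup.isCyclic_iff_exists_zpowers_eq_top _).1 hN.1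
    refine hCD (SimpleGraph.ConnectedComponent.sound (SimpleGraph.Reachable.trans (v := ⟨w, hw1⟩)
      (powerGraph_induce_reachable_of_mem_zpowers ?_)
      (powerGraph_induce_reachable_of_mem_zpowers ?_)))
    · exact hG.mem_zpowers_or_mem_zpowers (hxM (mem_zpowers _)) hwM
    · exact hG.mem_zpowers_or_mem_zpowers hwN (hyN (mem_zpowers _))
  refine ⟨M, N, ?_, hM, hN, hcard x M x.2 hxp hxM, hcard y N y.2 hyp hyN, hMN⟩
  rintro rfl
  rw [inf_idem] at hMN
  exact x.2 (mem_bot.1 (hMN ▸ hxM (mem_zpowers _)))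

theorem powerGraph_connectivity_ne_of_isCyclic (hG : IsPGroup p G) [IsCyclic G] :
    (powerGraph G).vertexConnectivity ≠ (powerGraph G).cyclicVertexConnectivity := by
  have hcut : ∀ S, ¬ (powerGraph G).IsVertexCutset S := by
    refine fun S hS => hS fun a b => powerGraph_induce_reachable_of_mem_zpowers ?_
    obtain ⟨m, hm⟩ := IsCyclic.exists_generator (α := G)
    exact hG.mem_zpowers_or_mem_zpowers (hm a) (hm b)
  have htop : (powerGraph G).cyclicVertexConnectivity = ⊤ := by
    simp only [SimpleGraph.cyclicVertexConnectivity, iInf_eq_top]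
    exact fun S hS => absurd hS.1 (hcut S)
  rw [htop]
  refine ne_of_lt (lt_of_le_of_lt (iInf₂_le Set.univ (Or.inr (by simp))) ?_)
  exact Set.encard_lt_top_iff.2 Set.finite_univ

theorem powerGraph_connectivity_ne_of_unique_involution (hG : IsPGroup 2 G)
    (hcyc : ¬ IsCyclic G) (huniq : ∀ u v : G, orderOf u = 2 → orderOf v = 2 → u ∈ zpowers v) :
    (powerGraph G).vertexConnectivity ≠ (powerGraph G).cyclicVertexConnectivity := by
  obtain ⟨u, v, hu, hv, huv⟩ := hG.exists_orderOf_eq_four_not_mem_zpowers hcyc huniq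
  obtain ⟨z, -, hz⟩ := hG.exists_mem_zpowers_orderOf_eq_prime (x := u)
    (by rintro rfl; simp at hu)
  have hz1 : z ≠ 1 := by rintro rfl; simp at hz
  have hzu : ∀ w : G, w ^ 2 = 1 → w = 1 ∨ w = z := by
    intro w hw
    by_cases hw1 : w = 1
    · exact .inl hw1
    right
    obtain ⟨i, rfl⟩ := mem_zpowers_iff.1 (huniq w z (orderOf_eq_prime hw hw1) hz)
    rcases Int.even_or_odd' i with ⟨j, rfl | rfl⟩
    · refine absurd ?_ hw1
      rw [zpow_mul, zpow_ofNat, ← hz, pow_orderOf_eq_one, one_zpow]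
    · rw [zpow_add, zpow_mul, zpow_ofNat, ← hz, pow_orderOf_eq_one, one_zpow, one_mul, zpow_one]
  have hord : ∀ x ∉ ({1, z} : Set G), 4 ∣ orderOf x := by
    intro x hx
    obtain ⟨n, hn⟩ := hG.exists_orderOf_eq_pow x
    have hn2 : 2 ≤ n := by
      by_contra hlt
      refine hx (hzu x (orderOf_dvd_iff_pow_eq_one.1 ?_))
      rw [hn]
      exact pow_dvd_pow 2 (by omega : n ≤ 1)
    rw [hn]
    exact pow_dvd_pow 2 hn2
  have hzadj : ∀ x, x ≠ z → (powerGraph G).Adj z x := by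
    intro x hx
    by_cases hx1 : x = 1
    · exact hx1 ▸ (powerGraph_one_adj hz1).symm
    obtain ⟨w, hwx, hw⟩ := hG.exists_mem_zpowers_orderOf_eq_prime hx1
    exact ⟨hx.symm, .inl (zpowers_le.2 hwx (huniq z w hz hw))⟩
  have hne : ∀ x : G, orderOf x = 4 → x ∉ ({1, z} : Set G) := by
    rintro x hx (rfl | rfl)
    · simp at hx
    · omega
  have hκ : (powerGraph G).vertexConnectivity ≤ 2 := by
    refine (iInf₂_le ({1, z} : Set G) (Or.inl (powerGraph_isVertexCutset (u := u)
      (fun x hx => hu ▸ hord x hx) (hne u hu) (hne v hv) (mem_zpowers u) huv))).trans ?_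
    rw [Set.encard_pair hz1.symm]
  obtain ⟨g, hg2, hg⟩ := hG.exists_sq_eq_and_mem_zpowers hz hzu
    (fun h => hcyc (isCyclic_iff_exists_zpowers_eq_top.2 ⟨z, h⟩))
  have hg1 : g ≠ 1 := by
    rintro rfl
    exact hz1 (by simpa using hg2.symm)
  have hgz : g ≠ z := by
    rintro rfl
    rw [pow_two] at hg2
    exact hg1 (mul_eq_left.1 hg2)
  have hcκ : 3 ≤ (powerGraph G).cyclicVertexConnectivity := by
    refine le_iInf₂ fun S hS => ?_
    obtain ⟨hcut, C, D, hCD, hC, hD⟩ := hS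
    have h1S : (1 : G) ∈ S := hcut.mem_of_forall_adj fun _ => powerGraph_one_adj
    have hzS : z ∈ S := hcut.mem_of_forall_adj hzadj
    have hgx : ∀ x : G, x ∉ S → orderOf x ≠ 4 → g ∈ zpowers x := by
      refine fun x hx hx4 => hg x fun h => hx4 (Nat.dvd_antisymm (orderOf_dvd_of_pow_eq_one h) ?_)
      refine hord x ?_
      rintro (rfl | rfl)
      · exact hx h1S
      · exact hx hzS
    obtain ⟨x, rfl, hx4⟩ := powerGraph_exists_orderOf_ne_of_not_isAcyclic le_rfl hC
    obtain ⟨y, rfl, hy4⟩ := powerGraph_exists_orderOf_ne_of_not_isAcyclic le_rfl hD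
    -- Each of `C` and `D` contains an element of order other than 4, of which `g` is a power; if
    -- `g` survived, it would join them.
    have hgS : g ∈ S := by
      by_contra hgS
      exact hCD (SimpleGraph.ConnectedComponent.sound (SimpleGraph.Reachable.trans (v := ⟨g, hgS⟩)
        (powerGraph_induce_reachable_of_mem_zpowers (.inr (hgx x x.2 hx4)))
        (powerGraph_induce_reachable_of_mem_zpowers (.inl (hgx y y.2 hy4)))))
    have hsub : ({1, z, g} : Set G) ⊆ S := by
      rintro w (rfl | rfl | rfl) <;> assumption
    have h3 : ({1, z, g} : Set G).encard = 3 :=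
      Set.encard_eq_three.2 ⟨1, z, g, hz1.symm, hg1.symm, hgz.symm, rfl⟩
    exact h3 ▸ Set.encard_le_encard hsub
  exact ne_of_lt (lt_of_le_of_lt hκ (lt_of_lt_of_le (by norm_num) hcκ))

end Connectivity

theorem theorem2 (p : ℕ) [Fact p.Prime] (G : Type*) [Group G] [Finite G] (hG : IsPGroup p G) :
    ((powerGraph G).vertexConnectivity = (powerGraph G).cyclicVertexConnectivity ↔
      PowerGraphCondition p G) ∧
    (PowerGraphCondition p G →
      (powerGraph G).vertexConnectivity = 1 ∧ (powerGraph G).cyclicVertexConnectivity = 1) := by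
  refine ⟨⟨fun h => ?_, fun h => ?_⟩, powerGraph_connectivity_eq_one hG⟩
  · by_cases hex : ∃ u v : G, orderOf u = p ∧ orderOf v = p ∧ u ∉ zpowers v
    · obtain ⟨u, v, hu, hv, huv⟩ := hex
      exact powerGraphCondition_of_not_mem_zpowers hG hu hv huv h
    by_cases hcyc : IsCyclic G
    · exact absurd h (powerGraph_connectivity_ne_of_isCyclic hG)
    by_cases hp2 : p = 2
    · subst hp2
      push Not at hex
      exact absurd h (powerGraph_connectivity_ne_of_unique_involution hG hcyc hex)
    · exact absurd (hG.exists_orderOf_eq_prime_not_mem_zpowers hp2 hcyc) hex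
  · obtain ⟨h1, h2⟩ := powerGraph_connectivity_eq_one hG h
    rw [h1, h2]
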